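/- **Setting (Bayesian interference game).** Two players $i\in\{1,2\}$; $j\neq i$ denotes the opponent of $i$. The channel coefficients $H_{iq}$, $i,q\in\{1,2\}$, are complex random variables whose gains $|H_{iq}|^2$ are independent. For power $\bar p>0$ and noise variance $\sigma^2>0$ put $X_i=|H_{ii}|^2\bar p/\sigma^2$ (SNR), $Y_i=|H_{ij}|^2\bar p/\sigma^2$ (INR), $Z_i=Y_i/X_i$. Each player has two actions, FDM ($\theta=1$) and FS ($\theta=1/2$), and observes only $(X_i,Y_i)=(x,y)$. His utility $u(\theta_i,\theta_j,x,y)$ is $$u(1,1)=\tfrac12\log_2(1+x),\qquad u(1,\tfrac12)=\tfrac12\log_2\Bigl(1+\frac{x}{1+y/2}\Bigr),$$ $$u(\tfrac12,1)=\tfrac12\log_2\Bigl(1+\frac x2\Bigr)+\tfrac12\log_2\Bigl(1+\frac{x/2}{1+y}\Bigr),\qquad u(\tfrac12,\tfrac12)=\log_2\Bigl(1+\frac{x/2}{1+y/2}\Bigr).$$ A strategy $S_i$ maps $(x,y)$ to an action, and $\pi_i(S_i,S_j,x,y)=\mathbb E\,[\,u(S_i(x,y),S_j(X_j,Y_j),x,y)\,]$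 is the conditional expected payoff given $(X_i,Y_i)=(x,y)$. For $\epsilon\ge 0$ a profile $(\hat S_1,\hat S_2)$ is an $\epsilon$-near Nash equilibrium if $\pi_i(\hat S_i,\hat S_j,x,y)\ge\sup_{S_i}\pi_i(S_i,\hat S_j,x,y)-\epsilon$ for both $i$ and all $x,y>0$. For $a\in[0,1]$ let $e(x,y,a)=a\,u(1,1)+(1-a)\,u(1,\tfrac12)-a\,u(\tfrac12,1)-(1-a)\,u(\tfrac12,\tfrac12)$, and let the best response $\check S(x,y,a)$ be FDM if $e(x,y,a)>0$ and $y/x>\tfrac12$, and FS otherwise. For $0<a\le1$ let $q(a)\in[\tfrac12,\infty)$ be the unique solution $q\ge\tfrac12$ of $$\tfrac12\log_2 q-\log_2(1+q)+\tfrac12\log_2(2+q)+a\bigl(1+\log_2(1+q)-\tfrac12\log_2(2+q)-\tfrac12\log_2(1+2q)\bigr)=0,$$ and let $q(0)=\infty$. Let $F_W$ be the distribution function of $W$, with $F_W(\infty)=1$. Consider the system $$a_1=1-F_{Z_1}(q(a_2)),\qquad a_2=1-F_{Z_2}(q(a_1)),\tag{$*$}$$ whose solutions do not depend on $\bar p$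 or $\sigma$, and, for a solution $(\hat a_1,\hat a_2)$, the profile $$\hat S_1(x,y)=\check S(x,y,\hat a_2),\qquad \hat S_2(x,y)=\check S(x,y,\hat a_1).\tag{$**$}$$ **Theorem.** Assume that the gains $|H_{iq}|^2$ are continuous random variables (their distribution functions are continuous). 1. For every $\sigma>0$ and $\epsilon>0$ there is $\bar p_0$ such that for every $\bar p>\bar p_0$ and every solution of $(*)$ the profile $(**)$ is an $\epsilon$-near Nash equilibrium. If $\mathbb E|H_{11}|^2$ and $\mathbb E|H_{22}|^2$ are finite, then equivalently: for every $\epsilon>0$ there is $\overline{SNR}_0$ such that the same holds whenever $\mathbb E X_i>\overline{SNR}_0$ for $i=1,2$. 2. Suppose moreover that the gains have finite nonzero moments and have densities that are bounded on $(0,\infty)$. Then for every $0<\nu<1$ there is a constant $K$ (depending only on $\nu$ and on the distributions of the gains) such that for every $\sigma>0$, for all sufficiently large $\bar p$, every solution of $(*)$ and each $i\in\{1,2\}$, the profile $(**)$ is an $\epsilon$-near Nash equilibrium with $$\epsilon=K\left(\frac{\sigma^2}{\bar p}+\sum_{q=1}^2F_{|H_{ii}|^2}\Bigl(\frac{\sigma^2}{\bar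 p^{\,1-\nu}}\Bigr)F_{|H_{iq}|^2}\Bigl(\frac{\sigma^2}{\bar p^{\,1-\nu}}\Bigr)\right).$$ -/

import Mathlib

open MeasureTheory ProbabilityTheory

namespace BIG

/-- The two actions of a player: frequency division (`θ = 1`) and full spread (`θ = 1/2`). -/
inductive Action : Type
  | FDM : Action
  | FS : Action

/-- Utility (in bits) of a player who plays the first action while the opponent plays the second
one, when the player's signal to noise ratio is `x` and interference to noise ratio is `y`. -/
noncomputable def utility : Action → Action → ℝ → ℝ → ℝ
  | .FDM, .FDM, x, _ => 1 / 2 * Real.logb 2 (1 + x)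
  | .FDM, .FS, x, y => 1 / 2 * Real.logb 2 (1 + x / (1 + y / 2))
  | .FS, .FDM, x, y =>
      1 / 2 * Real.logb 2 (1 + x / 2) + 1 / 2 * Real.logb 2 (1 + (x / 2) / (1 + y))
  | .FS, .FS, x, y => Real.logb 2 (1 + (x / 2) / (1 + y / 2))

/-- A pure strategy maps a player's private observation (SNR, INR) to an action. -/
abbrev Strategy : Type := ℝ → ℝ → Action

/-- The payoff of playing `θ` at observation `(x, y)` against an opponent who plays FDM with
probability `a`. -/
noncomputable def mixedPayoff (θ : Action) (a x y : ℝ) : ℝ :=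
  a * utility θ .FDM x y + (1 - a) * utility θ .FS x y

/-- Payoff advantage of FDM over FS at `(x, y)` if the opponent plays FDM with probability `a`. -/
noncomputable def advantage (x y a : ℝ) : ℝ :=
  mixedPayoff .FDM a x y - mixedPayoff .FS a x y

open Classical in
/-- The best response to an opponent who plays FDM with probability `a`. -/
noncomputable def bestResponse (a : ℝ) : Strategy := fun x y =>
  if 0 < advantage x y a ∧ 1 / 2 < y / x then .FDM else .FS

/-- The high-SNR limit of `advantage x (q * x) a`. -/
noncomputable def rFun (a q : ℝ) : ℝ :=
  Real.logb 2 q / 2 - Real.logb 2 (1 + q) + 1 / 2 * Real.logb 2 (2 + q)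
    + a * (1 + Real.logb 2 (1 + q) - 1 / 2 * Real.logb 2 (2 + q) - 1 / 2 * Real.logb 2 (1 + 2 * q))

/-- The interference to signal threshold `q(a)`: for `0 < a ≤ 1` the unique `s ≥ 1/2` with
`rFun a s = 0`, and `q(0) = ∞` (the infimum of the empty set); see `existsUnique_rFun_eq_zero`,
`threshold_eq` and `threshold_zero`. -/
noncomputable def threshold (a : ℝ) : EReal :=
  sInf {z : EReal | ∃ s : ℝ, 1 / 2 ≤ s ∧ rFun a s = 0 ∧ z = (s : EReal)}

section Game

variable {Ω : Type*} [MeasurableSpace Ω]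

/-- The channel gain `|H i q|²`. -/
noncomputable def gain (H : Fin 2 → Fin 2 → Ω → ℂ) (i q : Fin 2) (ω : Ω) : ℝ := ‖H i q ω‖ ^ 2

/-- Signal to noise ratio of player `i`, for noise variance `σ ^ 2` and power `p`. -/
noncomputable def snr (H : Fin 2 → Fin 2 → Ω → ℂ) (σ p : ℝ) (i : Fin 2) (ω : Ω) : ℝ :=
  gain H i i ω * p / σ ^ 2

/-- Interference to noise ratio of player `i`; the opponent of player `i` is player `1 - i`. -/
noncomputable def inr (H : Fin 2 → Fin 2 → Ω → ℂ) (σ p : ℝ) (i : Fin 2) (ω : Ω) : ℝ :=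
  gain H i (1 - i) ω * p / σ ^ 2

/-- Interference to signal ratio of player `i`. -/
noncomputable def isr (H : Fin 2 → Fin 2 → Ω → ℂ) (σ p : ℝ) (i : Fin 2) (ω : Ω) : ℝ :=
  inr H σ p i ω / snr H σ p i ω

/-- The private information (type) of player `i`. -/
noncomputable def playerType (H : Fin 2 → Fin 2 → Ω → ℂ) (σ p : ℝ) (i : Fin 2) (ω : Ω) : ℝ × ℝ :=
  (snr H σ p i ω, inr H σ p i ω)

/-- Conditional expected payoff `π_i(S_i, S_j, x, y)` of player `i` given his observation `(x, y)`.
The expectation over the opponent's type is taken under its law, which is the conditional law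
given player `i`'s type because types are independent; see `condDistrib_playerType`. -/
noncomputable def payoff (μ : Measure Ω) (H : Fin 2 → Fin 2 → Ω → ℂ) (σ p : ℝ) (i : Fin 2)
    (Si Sj : Strategy) (x y : ℝ) : ℝ :=
  ∫ t, utility (Si x y) (Sj t.1 t.2) x y ∂(μ.map (playerType H σ p (1 - i)))

/-- Player `i` cannot gain more than `ε` by deviating from the profile `S`, whatever positive
values `x`, `y` of his SNR and INR he observes. -/
def NoGain (μ : Measure Ω) (H : Fin 2 → Fin 2 → Ω → ℂ) (σ p ε : ℝ) (S : Fin 2 → Strategy)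
    (i : Fin 2) : Prop :=
  ∀ T : Strategy, ∀ x y : ℝ, 0 < x → 0 < y →
    payoff μ H σ p i T (S (1 - i)) x y - ε ≤ payoff μ H σ p i (S i) (S (1 - i)) x y

/-- `S` is an `ε`-near Nash equilibrium of the Bayesian interference game. -/
def IsNearNash (μ : Measure Ω) (H : Fin 2 → Fin 2 → Ω → ℂ) (σ p ε : ℝ) (S : Fin 2 → Strategy) :
    Prop :=
  ∀ i, NoGain μ H σ p ε S i

/-- Distribution function `F_Z(z) = P(Z ≤ z)` of a real random variable at an extended real. -/
noncomputable def distFun (μ : Measure Ω) (Z : Ω → ℝ) (z : EReal) : ℝ :=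
  μ.real {ω | (Z ω : EReal) ≤ z}

/-- `a` solves `a_i = 1 - F_{Z_i}(q(a_j))` for both players `i` (with opponents `j`). -/
def IsSolution (μ : Measure Ω) (H : Fin 2 → Fin 2 → Ω → ℂ) (σ p : ℝ) (a : Fin 2 → ℝ) : Prop :=
  ∀ i, a i = 1 - distFun μ (isr H σ p i) (threshold (a (1 - i)))

/-- The profile in which player `i` plays his best response to `a_j`. -/
noncomputable def profile (a : Fin 2 → ℝ) : Fin 2 → Strategy := fun i => bestResponse (a (1 - i))

/-- The regularity conditions on the channel gains: finite nonzero moments, and a density that is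
bounded on the positive half-line. -/
structure RegularGains (μ : Measure Ω) (H : Fin 2 → Fin 2 → Ω → ℂ) : Prop where
  moments : ∀ i q, ∀ k : ℕ,
    Integrable (fun ω => gain H i q ω ^ k) μ ∧ ∫ ω, gain H i q ω ^ k ∂μ ≠ 0
  density : ∀ i q, ∃ f : ℝ → ℝ, Measurable f ∧ (∀ h, 0 ≤ f h) ∧
    μ.map (gain H i q) = volume.withDensity (fun h => ENNReal.ofReal (f h)) ∧
    ∃ M : ℝ, ∀ h, 0 < h → f h ≤ M

/-- The quantity
`σ² / p + ∑_q F_{|H_ii|²}(σ² / p^(1-ν)) F_{|H_iq|²}(σ² / p^(1-ν))`. -/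
noncomputable def rate (μ : Measure Ω) (H : Fin 2 → Fin 2 → Ω → ℂ) (σ p ν : ℝ) (i : Fin 2) : ℝ :=
  σ ^ 2 / p + ∑ q : Fin 2,
    cdf (μ.map (gain H i i)) (σ ^ 2 / p ^ (1 - ν)) * cdf (μ.map (gain H i q)) (σ ^ 2 / p ^ (1 - ν))

end Game

/-! Well-definedness of the threshold and of the conditional payoff. -/

theorem rFun_eq (a : ℝ) {s : ℝ} (hs : 0 < s) :
    rFun a s = (1 - a) * (1 / 2 * Real.logb 2 (1 - 1 / (1 + s) ^ 2))
      + a * (1 / 2 * Real.logb 2 (2 - 2 / (1 + 2 * s))) := by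
  have e1 : 1 - 1 / (1 + s) ^ 2 = s * (2 + s) / (1 + s) ^ 2 := by field_simp; ring
  have e2 : 2 - 2 / (1 + 2 * s) = 2 ^ 2 * s / (1 + 2 * s) := by
    field_simp; ring
  have l4 : Real.logb 2 (2 ^ 2 : ℝ) = 2 := by
    rw [Real.logb_pow, Real.logb_self_eq_one (by norm_num)]; norm_num
  rw [e1, e2, Real.logb_div (by positivity) (by positivity),
    Real.logb_mul (by positivity) (by positivity), Real.logb_pow,
    Real.logb_div (by positivity) (by positivity),
    Real.logb_mul (by positivity) (by positivity), l4, rFun]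
  push_cast
  ring

theorem rFun_strictMono {a s t : ℝ} (h0 : 0 ≤ a) (h1 : a ≤ 1) (hs : 0 < s) (hst : s < t) :
    rFun a s < rFun a t := by
  have ht : 0 < t := hs.trans hst
  rw [rFun_eq a hs, rFun_eq a ht]
  have hA : Real.logb 2 (1 - 1 / (1 + s) ^ 2) < Real.logb 2 (1 - 1 / (1 + t) ^ 2) := by
    apply Real.logb_lt_logb (by norm_num)
    · rw [sub_pos, div_lt_one (by positivity)]; nlinarith
    · have : 1 / (1 + t) ^ 2 < 1 / (1 + s) ^ 2 := by gcongr
      linarith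
  have hB : Real.logb 2 (2 - 2 / (1 + 2 * s))
      < Real.logb 2 (2 - 2 / (1 + 2 * t)) := by
    apply Real.logb_lt_logb (by norm_num)
    · rw [sub_pos, div_lt_iff₀ (by positivity)]; linarith
    · have : 2 / (1 + 2 * t) < 2 / (1 + 2 * s) := by gcongr
      linarith
  rcases h0.eq_or_lt with rfl | h0
  · linarith
  · have := mul_lt_mul_of_pos_left hB h0
    have := mul_le_mul_of_nonneg_left hA.le (sub_nonneg.2 h1)
    linarith

theorem existsUnique_rFun_eq_zero {a : ℝ} (h0 : 0 < a) (h1 : a ≤ 1) :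
    ∃! s : ℝ, 1 / 2 ≤ s ∧ rFun a s = 0 := by
  have hcont : ContinuousOn (rFun a) (Set.Ici (1 / 2)) := by
    have hc : ∀ f : ℝ → ℝ, Continuous f → (∀ s ∈ Set.Ici (1 / 2 : ℝ), f s ≠ 0) →
        ContinuousOn (fun s => Real.logb 2 (f s)) (Set.Ici (1 / 2)) := fun f hf h =>
      (hf.continuousOn.log h).div_const _
    have hp : ∀ s ∈ Set.Ici (1 / 2 : ℝ), 0 < s := fun s hs =>
      lt_of_lt_of_le (by norm_num) (Set.mem_Ici.1 hs)
    have c1 := hc (fun s => s) (by fun_prop) (fun s hs => (hp s hs).ne')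
    have c2 := hc (fun s => 1 + s) (by fun_prop) (fun s hs => by have := hp s hs; positivity)
    have c3 := hc (fun s => 2 + s) (by fun_prop) (fun s hs => by have := hp s hs; positivity)
    have c4 := hc (fun s => 1 + 2 * s) (by fun_prop) (fun s hs => by have := hp s hs; positivity)
    unfold rFun
    fun_prop
  have hlow : rFun a (1 / 2) ≤ 0 := by
    rw [rFun_eq a (by norm_num)]
    have hA : Real.logb 2 (1 - 1 / (1 + 1 / 2 : ℝ) ^ 2) ≤ 0 :=
      Real.logb_nonpos (by norm_num) (by norm_num) (by norm_num)
    have hB : Real.logb 2 (2 - 2 / (1 + 2 * (1 / 2) : ℝ)) = 0 := by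
      norm_num
    rw [hB]
    nlinarith
  have hlim : Filter.Tendsto (rFun a) Filter.atTop (nhds (a / 2)) := by
    have hd : ∀ c : ℝ, Filter.Tendsto (fun s : ℝ => c / (1 + 2 * s)) Filter.atTop (nhds 0) := by
      intro c
      apply Filter.Tendsto.const_div_atTop
      apply Filter.tendsto_atTop_add_const_left
      exact Filter.tendsto_id.const_mul_atTop (by norm_num)
    have hsq : Filter.Tendsto (fun s : ℝ => 1 / (1 + s) ^ 2) Filter.atTop (nhds 0) := by
      apply Filter.Tendsto.const_div_atTop
      exact (Filter.tendsto_pow_atTop two_ne_zero).comp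
        (Filter.tendsto_atTop_add_const_left _ _ Filter.tendsto_id)
    have t1 : Filter.Tendsto (fun s : ℝ => Real.logb 2 (1 - 1 / (1 + s) ^ 2)) Filter.atTop
        (nhds (Real.logb 2 (1 - 0))) :=
      ((hsq.const_sub 1).log (by norm_num)).div_const _
    have t2 : Filter.Tendsto
        (fun s : ℝ => Real.logb 2 (2 - 2 / (1 + 2 * s))) Filter.atTop
        (nhds (Real.logb 2 (2 - 0))) :=
      (((hd 2).const_sub 2).log (by norm_num)).div_const _
    have t3 := ((t1.const_mul (1 / 2)).const_mul (1 - a)).add ((t2.const_mul (1 / 2)).const_mul a)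
    have e : (1 - a) * (1 / 2 * Real.logb 2 (1 - 0)) + a * (1 / 2 * Real.logb 2 (2 - 0))
        = a / 2 := by
      rw [sub_zero, sub_zero, Real.logb_self_eq_one (by norm_num), Real.logb_one]
      ring
    rw [e] at t3
    refine t3.congr' ?_
    filter_upwards [Filter.eventually_gt_atTop 0] with s hs
    exact (rFun_eq a hs).symm
  obtain ⟨t, htpos, ht⟩ := ((hlim.eventually (lt_mem_nhds (show 0 < a / 2 by positivity))).and
    (Filter.eventually_ge_atTop (1 / 2))).exists
  obtain ⟨s, hs, hs0⟩ := intermediate_value_Icc ht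
    (hcont.mono Set.Icc_subset_Ici_self) (Set.mem_Icc.2 ⟨hlow, htpos.le⟩)
  refine ⟨s, ⟨hs.1, hs0⟩, ?_⟩
  rintro u ⟨hu, hu0⟩
  have hsp : 0 < s := lt_of_lt_of_le (by norm_num) hs.1
  have hup : 0 < u := lt_of_lt_of_le (by norm_num) hu
  rcases lt_trichotomy u s with h | h | h
  · have := rFun_strictMono h0.le h1 hup h; linarith
  · exact h
  · have := rFun_strictMono h0.le h1 hsp h; linarith

theorem threshold_eq {a s : ℝ} (h0 : 0 < a) (h1 : a ≤ 1) (hs : 1 / 2 ≤ s) (h : rFun a s = 0) :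
    threshold a = (s : EReal) := by
  have hset : {z : EReal | ∃ s : ℝ, 1 / 2 ≤ s ∧ rFun a s = 0 ∧ z = (s : EReal)} = {(s : EReal)} := by
    ext z
    constructor
    · rintro ⟨u, hu, hu0, rfl⟩
      rw [(existsUnique_rFun_eq_zero h0 h1).unique ⟨hu, hu0⟩ ⟨hs, h⟩]
      rfl
    · rintro rfl
      exact ⟨s, hs, h, rfl⟩
  rw [threshold, hset, sInf_singleton]

theorem threshold_zero : threshold 0 = ⊤ := by
  have hset : {z : EReal | ∃ s : ℝ, 1 / 2 ≤ s ∧ rFun 0 s = 0 ∧ z = (s : EReal)} = ∅ := by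
    ext z
    refine ⟨?_, fun h => h.elim⟩
    rintro ⟨s, hs, h, -⟩
    exfalso
    have hsp : 0 < s := lt_of_lt_of_le (by norm_num) hs
    rw [rFun_eq 0 hsp] at h
    have h1 : 1 / (1 + s) ^ 2 < 1 := by rw [div_lt_one (by positivity)]; nlinarith
    have h2 : 0 < 1 / (1 + s) ^ 2 := by positivity
    have : Real.logb 2 (1 - 1 / (1 + s) ^ 2) < 0 :=
      Real.logb_neg (by norm_num) (by linarith) (by linarith)
    linarith
  rw [threshold, hset, sInf_empty]

/-- Given player `i`'s type, the conditional law of the opponent's type is its law. -/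
theorem condDistrib_playerType {Ω : Type*} [MeasurableSpace Ω] (μ : Measure Ω)
    [IsProbabilityMeasure μ] (H : Fin 2 → Fin 2 → Ω → ℂ) (hH : ∀ i q, Measurable (H i q))
    (hind : iIndepFun (fun k : Fin 2 × Fin 2 => gain H k.1 k.2) μ) (σ p : ℝ) (i : Fin 2) :
    ∀ᵐ t ∂(μ.map (playerType H σ p i)),
      condDistrib (playerType H σ p (1 - i)) (playerType H σ p i) μ t
        = μ.map (playerType H σ p (1 - i)) := by
  have hg : ∀ i q, Measurable (gain H i q) := fun i q => (hH i q).norm.pow_const 2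
  have hT : ∀ i, Measurable (playerType H σ p i) := fun i =>
    (((hg i i).mul_const p).div_const (σ ^ 2)).prodMk
      (((hg i (1 - i)).mul_const p).div_const (σ ^ 2))
  have hne : i ≠ 1 - i := by fin_cases i <;> simp
  have h0 := hind.indepFun_prodMk_prodMk (fun k => hg k.1 k.2)
    (i, i) (i, 1 - i) (1 - i, 1 - i) (1 - i, 1 - (1 - i))
    (by simp [hne]) (by simp [hne]) (by simp [hne]) (by simp [hne])
  have hscale : Measurable (fun u : ℝ × ℝ => (u.1 * p / σ ^ 2, u.2 * p / σ ^ 2)) := by fun_prop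
  have hI : IndepFun (playerType H σ p i) (playerType H σ p (1 - i)) μ := h0.comp hscale hscale
  have : IsProbabilityMeasure (μ.map (playerType H σ p (1 - i))) :=
    Measure.isProbabilityMeasure_map (hT _).aemeasurable
  have hprod : μ.map (fun ω => (playerType H σ p i ω, playerType H σ p (1 - i) ω))
      = (μ.map (playerType H σ p i)).compProd
        (Kernel.const (ℝ × ℝ) (μ.map (playerType H σ p (1 - i)))) := by
    have : IsProbabilityMeasure (μ.map (playerType H σ p i)) :=
      Measure.isProbabilityMeasure_map (hT _).aemeasurable
    rw [Measure.compProd_const]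
    exact (indepFun_iff_map_prod_eq_prod_map_map (hT i).aemeasurable
      (hT (1 - i)).aemeasurable).1 hI
  have key := condDistrib_ae_eq_of_measure_eq_compProd (playerType H σ p i)
    (hT (1 - i)).aemeasurable hprod
  filter_upwards [key] with t ht
  rw [ht, Kernel.const_apply]

end BIG

namespace BIG

/-! The advantage of FDM and its limit `rFun` are the same convex combination of a nonpositive and a
second logarithm, with arguments differing only in lower-order terms. Shifting `x` by 4 absorbs
these terms: the advantage at `(x, y)` is at most `rFun a (y / (x - 4))` and at least a positive
multiple of `rFun a (y / (x + 4))`. As `rFun a` increases through 0 at `q = q(a)`, the best response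
is the rule `q < y / x` except when `x` is within 4 of `y / q` (`bestResponse_eq_FDM_iff`).

In terms of the gains, the exceptional event puts the direct gain within `4σ²/p` of a multiple of
the independent cross gain. Its probability is at most the largest mass the direct gain gives an
interval of that half-width, whatever `q` is. So for a solution `a` the true FDM probability `b` of
a player is close to his `a` (`abs_one_sub_distFun_sub_fdmProb_le`).

Best responding to `a` instead of `b` costs at most `|a - b|` (`mixedPayoff_sub_le`). The interval
mass tends to 0 for atomless laws, and is `O(σ²/p)` for bounded densities, which is within the first
term of `rate`. -/

/-! ### Comparison of the advantage with its high-SNR limit -/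

theorem advantage_eq (a : ℝ) {x y : ℝ} (hx : 0 ≤ x) (hy : 0 ≤ y) :
    advantage x y a = (1 - a) * (-(1 / 2 * Real.logb 2 (1 + x ^ 2 / ((2 + y) * (2 + y + 2 * x)))))
      + a * (1 / 2 * Real.logb 2 (1 + x * (2 * y - x) / ((2 + x) * (2 + 2 * y + x)))) := by
  have e0 : 1 + x ^ 2 / ((2 + y) * (2 + y + 2 * x))
      = (1 + (x / 2) / (1 + y / 2)) ^ 2 / (1 + x / (1 + y / 2)) := by
    have : (2 + y + 2 * x) ≠ 0 := by positivity
    have : (2 + y) ≠ 0 := by positivity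
    have h1 : 1 + x / (1 + y / 2) = (2 + y + 2 * x) / (2 + y) := by field_simp
    have h2 : 1 + (x / 2) / (1 + y / 2) = (2 + y + x) / (2 + y) := by field_simp
    rw [h1, h2]
    field_simp
    ring
  have e1 : 1 + x * (2 * y - x) / ((2 + x) * (2 + 2 * y + x))
      = (1 + x) / ((1 + x / 2) * (1 + (x / 2) / (1 + y))) := by
    have : (2 + 2 * y + x) ≠ 0 := by positivity
    have : (2 + x) ≠ 0 := by positivity
    have h1 : 1 + (x / 2) / (1 + y) = (2 + 2 * y + x) / (2 * (1 + y)) := by field_simp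
    have h2 : 1 + x / 2 = (2 + x) / 2 := by field_simp
    rw [h1, h2]
    field_simp
    ring
  rw [e0, e1, Real.logb_div (by positivity) (by positivity), Real.logb_pow,
    Real.logb_div (by positivity) (by positivity), Real.logb_mul (by positivity) (by positivity)]
  simp only [advantage, mixedPayoff, utility]
  push_cast
  ring

/-- Puts the limit in the shape of `advantage_eq`, so that the two can be compared one logarithm at
a time. -/
theorem rFun_div_eq (a : ℝ) {x y : ℝ} (hx : 0 < x) (hy : 0 < y) :
    rFun a (y / x) = (1 - a) * (-(1 / 2 * Real.logb 2 (1 + x ^ 2 / (y * (y + 2 * x)))))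
      + a * (1 / 2 * Real.logb 2 (1 + (2 * y - x) / (2 * y + x))) := by
  have e0 : 1 - 1 / (1 + y / x) ^ 2 = (1 + x ^ 2 / (y * (y + 2 * x)))⁻¹ := by
    field_simp
    ring
  have e1 : 2 - 2 / (1 + 2 * (y / x)) = 1 + (2 * y - x) / (2 * y + x) := by
    field_simp
    ring
  rw [rFun_eq a (by positivity), e0, e1, Real.logb_inv]
  ring

/-- FDM never pays when the interference is at most half of the signal. -/
theorem advantage_nonpos {a x y : ℝ} (h0 : 0 ≤ a) (h1 : a ≤ 1) (hx : 0 ≤ x) (hy : 0 ≤ y)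
    (h : 2 * y ≤ x) : advantage x y a ≤ 0 := by
  rw [advantage_eq a hx hy]
  have hA : 0 ≤ Real.logb 2 (1 + x ^ 2 / ((2 + y) * (2 + y + 2 * x))) :=
    Real.logb_nonneg (by norm_num) (by rw [le_add_iff_nonneg_right]; positivity)
  have hneg : x * (2 * y - x) / ((2 + x) * (2 + 2 * y + x)) ≤ 0 :=
    div_nonpos_of_nonpos_of_nonneg (mul_nonpos_of_nonneg_of_nonpos hx (by linarith))
      (by positivity)
  have hlow : -1 ≤ x * (2 * y - x) / ((2 + x) * (2 + 2 * y + x)) := by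
    rw [le_div_iff₀ (by positivity)]
    nlinarith [mul_nonneg hx hy]
  have hB : Real.logb 2 (1 + x * (2 * y - x) / ((2 + x) * (2 + 2 * y + x))) ≤ 0 :=
    Real.logb_nonpos (by norm_num) (by linarith) (by linarith)
  have := mul_nonneg (sub_nonneg.2 h1) hA
  have := mul_nonpos_of_nonneg_of_nonpos h0 hB
  linarith

/-- FDM never pays against an opponent who always plays FS. -/
theorem advantage_zero_nonpos {x y : ℝ} (hx : 0 ≤ x) (hy : 0 ≤ y) : advantage x y 0 ≤ 0 := by
  rw [advantage_eq 0 hx hy]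
  have hA : 0 ≤ Real.logb 2 (1 + x ^ 2 / ((2 + y) * (2 + y + 2 * x))) :=
    Real.logb_nonneg (by norm_num) (by rw [le_add_iff_nonneg_right]; positivity)
  linarith

/-- The advantage is affine in the probability. For `x ≤ 2 * y` its slope is the mean of two values
`log₂ (1 + w)` with `0 ≤ w ≤ 1`, hence lies in `[0, 1]`. -/
theorem abs_advantage_sub_le {x y : ℝ} (a b : ℝ) (hx : 0 ≤ x) (hy : 0 ≤ y) (h : x ≤ 2 * y) :
    |advantage x y a - advantage x y b| ≤ |a - b| := by
  have key : ∀ w : ℝ, 0 ≤ w → w ≤ 1 → 0 ≤ Real.logb 2 (1 + w) ∧ Real.logb 2 (1 + w) ≤ 1 := by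
    intro w hw0 hw1
    refine ⟨Real.logb_nonneg (by norm_num) (by linarith), ?_⟩
    rw [Real.logb_le_iff_le_rpow (by norm_num) (by linarith), Real.rpow_one]
    linarith
  obtain ⟨hA0, hA1⟩ := key (x ^ 2 / ((2 + y) * (2 + y + 2 * x))) (by positivity) (by
    rw [div_le_one (by positivity)]
    nlinarith [mul_nonneg hx hy])
  obtain ⟨hB0, hB1⟩ := key (x * (2 * y - x) / ((2 + x) * (2 + 2 * y + x)))
    (div_nonneg (mul_nonneg hx (by linarith)) (by positivity)) (by
      rw [div_le_one (by positivity)]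
      nlinarith [mul_nonneg hx hy])
  rw [advantage_eq a hx hy, advantage_eq b hx hy]
  set A := Real.logb 2 (1 + x ^ 2 / ((2 + y) * (2 + y + 2 * x)))
  set B := Real.logb 2 (1 + x * (2 * y - x) / ((2 + x) * (2 + 2 * y + x)))
  have e : (1 - a) * (-(1 / 2 * A)) + a * (1 / 2 * B)
      - ((1 - b) * (-(1 / 2 * A)) + b * (1 / 2 * B)) = (a - b) * ((A + B) / 2) := by ring
  rw [e, abs_mul]
  refine mul_le_of_le_one_right (abs_nonneg _) ?_
  rw [abs_of_nonneg (by linarith)]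
  linarith

theorem advantage_le_rFun {a x y : ℝ} (h0 : 0 ≤ a) (h1 : a ≤ 1) (hx : 4 < x) (h : x ≤ 2 * y) :
    advantage x y a ≤ rFun a (y / (x - 4)) := by
  have hy : 0 < y := by linarith
  have hx4 : 0 < x - 4 := by linarith
  have hxp : 0 < x := by linarith
  rw [advantage_eq a hxp.le hy.le, rFun_div_eq a hx4 hy]
  have hA : Real.logb 2 (1 + (x - 4) ^ 2 / (y * (y + 2 * (x - 4))))
      ≤ Real.logb 2 (1 + x ^ 2 / ((2 + y) * (2 + y + 2 * x))) := by
    apply Real.logb_le_logb_of_le (by norm_num) (by positivity)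
    gcongr 1 + ?_
    rw [div_le_div_iff₀ (by positivity) (by positivity)]
    have i1 : (x - 4) * (2 + y) ≤ x * y := by linarith
    have i2 : (x - 4) * (2 + y + 2 * x) ≤ x * (y + 2 * (x - 4)) := by linarith
    have := mul_le_mul i1 i2 (by positivity) (by positivity)
    linarith
  have hB : Real.logb 2 (1 + x * (2 * y - x) / ((2 + x) * (2 + 2 * y + x)))
      ≤ Real.logb 2 (1 + (2 * y - (x - 4)) / (2 * y + (x - 4))) := by
    have : 0 ≤ x * (2 * y - x) / ((2 + x) * (2 + 2 * y + x)) :=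
      div_nonneg (mul_nonneg hxp.le (by linarith)) (by positivity)
    apply Real.logb_le_logb_of_le (by norm_num) (by linarith)
    gcongr 1 + ?_
    rw [div_le_div_iff₀ (by positivity) (by positivity)]
    have i1 : x ≤ 2 + x := by linarith
    have i2 : (2 * y - x) * (2 * y + (x - 4)) ≤ (2 * y - (x - 4)) * (2 + 2 * y + x) := by
      nlinarith
    have := mul_le_mul i1 i2 (mul_nonneg (by linarith) (by linarith)) (by positivity)
    linarith
  have := mul_le_mul_of_nonneg_left hA (sub_nonneg.2 h1)
  have := mul_le_mul_of_nonneg_left hB h0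
  linarith

/-- Bernoulli's inequality for exponents in `[0, 1]`. It moves the factor `x / (2 + x)` inside the
logarithm, where the exact advantage also carries it. -/
theorem mul_logb_one_add_le {l w : ℝ} (hl0 : 0 ≤ l) (hl1 : l ≤ 1) (hw : 0 ≤ w) :
    l * Real.logb 2 (1 + w) ≤ Real.logb 2 (1 + l * w) := by
  have h : (1 + w) ^ l ≤ 1 + l * w :=
    rpow_one_add_le_one_add_mul_self (by linarith) hl0 hl1
  calc l * Real.logb 2 (1 + w) = Real.logb 2 ((1 + w) ^ l) := by
        rw [Real.logb_rpow_eq_mul_logb_of_pos (by linarith)]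
    _ ≤ _ := Real.logb_le_logb_of_le (by norm_num) (Real.rpow_pos_of_pos (by linarith) _) h

/-- The lower bound carries the factor `x / (2 + x)`, so the negative logarithm must gain that
factor from the shift of `x`. -/
theorem log_one_add_le_mul_log {x y : ℝ} (hx : 0 < x) (h : x + 4 ≤ 2 * y) :
    Real.log (1 + x ^ 2 / ((2 + y) * (2 + y + 2 * x)))
      ≤ x / (2 + x) * Real.log (1 + (x + 4) ^ 2 / (y * (y + 2 * (x + 4)))) := by
  have hy : 0 < y := by linarith
  set A := x ^ 2 / ((2 + y) * (2 + y + 2 * x)) with hA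
  set B := (x + 4) ^ 2 / (y * (y + 2 * (x + 4))) with hB
  have hA0 : 0 < A := by positivity
  have hB0 : 0 < B := by positivity
  have hB1 : B ≤ 1 := by
    rw [hB, div_le_one (by positivity)]
    nlinarith
  -- The goal is `2 log(1+A) ≤ x (log(1+B) - log(1+A))`. Since `log(1+A) ≤ A` and the difference of
  -- logarithms is at least `(B-A)/2`, it suffices that `4A ≤ x(B-A)`; this is where the shift 4
  -- enters.
  have hAB : A * (x + 4) ≤ x * B := by
    rw [hA, hB, div_mul_eq_mul_div, ← mul_div_assoc,
      div_le_div_iff₀ (by positivity) (by positivity)]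
    have i1 : y ≤ 2 + y := by linarith
    have i2 : x * (y + 2 * (x + 4)) ≤ (x + 4) * (2 + y + 2 * x) := by nlinarith
    have := mul_le_mul i1 i2 (by positivity) (by positivity)
    have := mul_le_mul_of_nonneg_left this (show 0 ≤ x * (x + 4) by positivity)
    linarith
  have l1 : Real.log (1 + A) ≤ A := by
    have := Real.log_le_sub_one_of_pos (show 0 < 1 + A by positivity)
    linarith
  have l2 : (B - A) / (1 + B) ≤ Real.log (1 + B) - Real.log (1 + A) := by
    rw [← Real.log_div (by positivity) (by positivity)]
    have := Real.one_sub_inv_le_log_of_pos (show 0 < (1 + B) / (1 + A) by positivity)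
    refine le_trans (le_of_eq ?_) this
    field_simp
    ring
  have hBA : 0 ≤ B - A := by nlinarith
  have l3 : (B - A) / 2 ≤ (B - A) / (1 + B) := by gcongr; linarith
  rw [div_mul_eq_mul_div, le_div_iff₀ (by positivity)]
  nlinarith [mul_le_mul_of_nonneg_left (l3.trans l2) hx.le]

theorem mul_rFun_le_advantage {a x y : ℝ} (h0 : 0 ≤ a) (h1 : a ≤ 1) (hx : 0 < x)
    (h : x + 4 ≤ 2 * y) : x / (2 + x) * rFun a (y / (x + 4)) ≤ advantage x y a := by
  have hy : 0 < y := by linarith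
  rw [advantage_eq a hx.le hy.le, rFun_div_eq a (by linarith) hy]
  have hA : Real.logb 2 (1 + x ^ 2 / ((2 + y) * (2 + y + 2 * x)))
      ≤ x / (2 + x) * Real.logb 2 (1 + (x + 4) ^ 2 / (y * (y + 2 * (x + 4)))) := by
    rw [Real.logb, Real.logb, ← mul_div_assoc]
    exact div_le_div_of_nonneg_right (log_one_add_le_mul_log hx h)
      (Real.log_nonneg (by norm_num))
  have hw : 0 ≤ (2 * y - (x + 4)) / (2 * y + (x + 4)) :=
    div_nonneg (by linarith) (by positivity)
  have hl1 : x / (2 + x) ≤ 1 := by rw [div_le_one (by positivity)]; linarith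
  have hB : x / (2 + x) * Real.logb 2 (1 + (2 * y - (x + 4)) / (2 * y + (x + 4)))
      ≤ Real.logb 2 (1 + x * (2 * y - x) / ((2 + x) * (2 + 2 * y + x))) := by
    refine (mul_logb_one_add_le (by positivity) hl1 hw).trans ?_
    apply Real.logb_le_logb_of_le (by norm_num) (by positivity)
    rw [mul_div_mul_comm]
    gcongr 1 + x / (2 + x) * ?_
    apply div_le_div₀ <;> linarith
  have := mul_le_mul_of_nonneg_left hA (sub_nonneg.2 h1)
  have := mul_le_mul_of_nonneg_left hB h0
  linarith

theorem bestResponse_eq_FDM {a x y : ℝ} :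
    bestResponse a x y = .FDM ↔ 0 < advantage x y a ∧ 1 / 2 < y / x := by
  unfold bestResponse
  split_ifs with h
  · exact iff_of_true rfl h
  · exact iff_of_false (by simp) h

/-- The best response and the threshold rule `q < y / x` agree unless `x` is within `4` of
`y / q`. -/
theorem bestResponse_eq_FDM_iff {a q x y : ℝ} (h0 : 0 < a) (h1 : a ≤ 1) (hq : 1 / 2 ≤ q)
    (hr : rFun a q = 0) (hx : 0 < x) (hy : 0 < y) (hfar : 4 < |x - q⁻¹ * y|) :
    bestResponse a x y = .FDM ↔ q < y / x := by
  have hq0 : 0 < q := by linarith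
  rw [bestResponse_eq_FDM]
  rcases lt_abs.1 hfar with hf | hf
  -- Here `x` exceeds `y / q` by more than 4: even after shrinking `x` by 4 the ratio stays below
  -- `q`, so the upper bound for the advantage is negative.
  · have hqy : 0 < q⁻¹ * y := by positivity
    have hlt : y / (x - 4) < q := by
      rw [div_lt_iff₀ (by linarith)]
      have : q * (q⁻¹ * y) < q * (x - 4) := mul_lt_mul_of_pos_left (by linarith) hq0
      rwa [mul_inv_cancel_left₀ hq0.ne'] at this
    have hle : y / x ≤ y / (x - 4) := by
      apply div_le_div_of_nonneg_left hy.le <;> linarith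
    refine iff_of_false ?_ (by linarith)
    rintro ⟨hadv, hz⟩
    have h2 : x ≤ 2 * y := by rw [lt_div_iff₀ hx] at hz; linarith
    have hr2 := rFun_strictMono h0.le h1 (div_pos hy (by linarith)) hlt
    have := advantage_le_rFun h0.le h1 (by linarith) h2
    linarith
  · have hlt : q < y / (x + 4) := by
      rw [lt_div_iff₀ (by linarith)]
      have : q * (x + 4) < q * (q⁻¹ * y) := mul_lt_mul_of_pos_left (by linarith) hq0
      rwa [mul_inv_cancel_left₀ hq0.ne'] at this
    have hle : y / (x + 4) ≤ y / x := by
      apply div_le_div_of_nonneg_left hy.le <;> linarith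
    refine iff_of_true ⟨?_, by linarith⟩ (by linarith)
    have h2 : x + 4 ≤ 2 * y := by
      have : 1 / 2 < y / (x + 4) := by linarith
      rw [lt_div_iff₀ (by linarith)] at this
      linarith
    have hr2 := rFun_strictMono h0.le h1 hq0 hlt
    rw [hr] at hr2
    exact lt_of_lt_of_le (by positivity) (mul_rFun_le_advantage h0.le h1 hx h2)

/-! ### Concentration of atomless laws -/

-- Splitting at 0 writes `f` through `f |x|` and `f (-|x|)`; each has a single limit at infinity in
-- both directions, so the one-limit criterion applies.
open Filter Topology in
theorem uniformContinuous_of_tendsto_atBot_atTop {f : ℝ → ℝ} {l m : ℝ} (hf : Continuous f)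
    (hb : Tendsto f atBot (𝓝 l)) (ht : Tendsto f atTop (𝓝 m)) : UniformContinuous f := by
  have habs : Tendsto (fun x : ℝ => |x|) (cocompact ℝ) atTop := tendsto_norm_cocompact_atTop
  have u1 : UniformContinuous fun x : ℝ => f |x| :=
    (hf.comp continuous_abs).uniformContinuous_of_tendsto_cocompact (ht.comp habs)
  have u2 : UniformContinuous fun x : ℝ => f (-|x|) :=
    (hf.comp continuous_abs.neg).uniformContinuous_of_tendsto_cocompact
      (hb.comp (tendsto_neg_atTop_atBot.comp habs))
  have c1 : UniformContinuous fun x : ℝ => max x 0 :=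
    (LipschitzWith.id.max_const 0).uniformContinuous
  have c2 : UniformContinuous fun x : ℝ => min x 0 :=
    (LipschitzWith.id.min_const 0).uniformContinuous
  have key : f = fun x => f |max x 0| + f (-|min x 0|) - f 0 := by
    funext x
    rcases le_total x 0 with h | h
    · simp [h, abs_of_nonpos h]
    · simp [h, abs_of_nonneg h]
  rw [key]
  exact ((u1.comp c1).add (u2.comp c2)).sub uniformContinuous_const

theorem continuous_cdf (ν : Measure ℝ) [IsProbabilityMeasure ν] [NullSingletonClass ν] :
    Continuous (cdf ν) := by
  rw [continuous_iff_continuousAt]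
  intro x
  rw [(cdf ν).mono.continuousAt_iff_leftLim_eq_rightLim, StieltjesFunction.rightLim_eq]
  have h : (cdf ν).measure {x} = 0 := by rw [measure_cdf, measure_singleton]
  rw [StieltjesFunction.measure_singleton, ENNReal.ofReal_eq_zero] at h
  exact le_antisymm ((cdf ν).mono.leftLim_le le_rfl) (by linarith)

/-- An atomless probability measure on the line gives uniformly small mass to short intervals. -/
theorem exists_forall_measure_Icc_le (ν : Measure ℝ) [IsProbabilityMeasure ν] [NullSingletonClass ν]
    {ε : ℝ} (hε : 0 < ε) :
    ∃ δ : ℝ, 0 < δ ∧ ∀ u, ν (Set.Icc (u - δ) (u + δ)) ≤ ENNReal.ofReal ε := by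
  have hu := uniformContinuous_of_tendsto_atBot_atTop (continuous_cdf ν) (tendsto_cdf_atBot ν)
    (tendsto_cdf_atTop ν)
  obtain ⟨δ, hδ, h⟩ := Metric.uniformContinuous_iff.1 hu ε hε
  refine ⟨δ / 3, by positivity, fun u => ?_⟩
  have hd := h (a := u + δ / 3) (b := u - δ / 3) (by
    rw [Real.dist_eq, abs_lt]; constructor <;> linarith)
  rw [← measure_congr (Ioc_ae_eq_Icc (μ := ν)), ← measure_cdf ν, StieltjesFunction.measure_Ioc]
  apply ENNReal.ofReal_le_ofReal
  rw [Real.dist_eq] at hd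
  exact (le_abs_self _).trans hd.le

/-- By Fubini: once `G'` is fixed, the event puts `G` in an interval centred at `c * G'`. Uniformity
in `c` matters, because `c = 1/q(a)` varies with the solution. -/
theorem measure_abs_sub_le_of_indepFun {Ω : Type*} [MeasurableSpace Ω] {μ : Measure Ω}
    [IsProbabilityMeasure μ] {G G' : Ω → ℝ} (hG : Measurable G) (hG' : Measurable G')
    (hI : IndepFun G G' μ) {δ : ℝ} {η : ENNReal}
    (h : ∀ u, μ.map G (Set.Icc (u - δ) (u + δ)) ≤ η) (c : ℝ) :
    μ {ω | |G ω - c * G' ω| ≤ δ} ≤ η := by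
  have : IsProbabilityMeasure (μ.map G) := Measure.isProbabilityMeasure_map hG.aemeasurable
  have : IsProbabilityMeasure (μ.map G') := Measure.isProbabilityMeasure_map hG'.aemeasurable
  have hS : MeasurableSet {z : ℝ × ℝ | |z.1 - c * z.2| ≤ δ} :=
    measurableSet_le (by fun_prop) (by fun_prop)
  have e : {ω | |G ω - c * G' ω| ≤ δ}
      = (fun ω => (G ω, G' ω)) ⁻¹' {z : ℝ × ℝ | |z.1 - c * z.2| ≤ δ} := rfl
  rw [e, ← Measure.map_apply (hG.prodMk hG') hS,
    (indepFun_iff_map_prod_eq_prod_map_map hG.aemeasurable hG'.aemeasurable).1 hI,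
    Measure.prod_apply_symm hS]
  calc _ ≤ ∫⁻ _, η ∂(μ.map G') := by
        apply lintegral_mono
        intro y
        refine (measure_mono ?_).trans (h (c * y))
        intro x hx
        have := abs_le.1 (show |x - c * y| ≤ δ from hx)
        exact ⟨by linarith, by linarith⟩
    _ = η := by simp

/-! ### Payoffs against a best-responding opponent -/

theorem measurableSet_bestResponse_eq_FDM (a : ℝ) :
    MeasurableSet {t : ℝ × ℝ | bestResponse a t.1 t.2 = .FDM} := by
  have e : {t : ℝ × ℝ | bestResponse a t.1 t.2 = .FDM}
      = {t : ℝ × ℝ | 0 < advantage t.1 t.2 a} ∩ {t : ℝ × ℝ | 1 / 2 < t.2 / t.1} := by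
    ext t
    exact bestResponse_eq_FDM
  rw [e]
  refine (measurableSet_lt measurable_const ?_).inter
    (measurableSet_lt measurable_const (by fun_prop))
  simp only [advantage, mixedPayoff, utility, Real.logb]
  fun_prop

/-- The loss from responding to `a` when the opponent plays FDM with probability `b`. -/
theorem mixedPayoff_sub_le {a b x y : ℝ} (hb0 : 0 ≤ b) (hb1 : b ≤ 1)
    (hx : 0 < x) (hy : 0 < y) (θ : Action) :
    mixedPayoff θ b x y - |a - b| ≤ mixedPayoff (bestResponse a x y) b x y := by
  have hnn := abs_nonneg (a - b)
  by_cases hz : 1 / 2 < y / x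
  · have h2 : x ≤ 2 * y := by rw [lt_div_iff₀ hx] at hz; linarith
    have hd := abs_le.1 (abs_advantage_sub_le a b hx.le hy.le h2)
    by_cases he : 0 < advantage x y a
    · have hbr : bestResponse a x y = .FDM := by simp only [bestResponse, he, hz, and_self, if_true]
      rw [hbr]
      cases θ
      · linarith
      · have e : advantage x y b = mixedPayoff .FDM b x y - mixedPayoff .FS b x y := rfl
        linarith
    · have hbr : bestResponse a x y = .FS := by simp only [bestResponse, he, false_and, if_false]
      rw [hbr]
      cases θ
      · have e : advantage x y b = mixedPayoff .FDM b x y - mixedPayoff .FS b x y := rfl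
        linarith
      · linarith
  · have hbr : bestResponse a x y = .FS := by simp only [bestResponse, hz, and_false, if_false]
    have h2 : 2 * y ≤ x := by rw [lt_div_iff₀ hx] at hz; linarith
    -- In this region FS is optimal against every `b`, so nothing is lost.
    have := advantage_nonpos hb0 hb1 hx.le hy.le h2
    rw [hbr]
    cases θ
    · have e : advantage x y b = mixedPayoff .FDM b x y - mixedPayoff .FS b x y := rfl
      linarith
    · linarith

/-- Probability that a player of type `(X, Y)` plays FDM when he best responds to `a`. -/
noncomputable def fdmProb {Ω : Type*} [MeasurableSpace Ω] (μ : Measure Ω)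
    (H : Fin 2 → Fin 2 → Ω → ℂ) (σ p : ℝ) (j : Fin 2) (a : ℝ) : ℝ :=
  μ.real {ω | bestResponse a (snr H σ p j ω) (inr H σ p j ω) = .FDM}

theorem snr_eq {Ω : Type*} (H : Fin 2 → Fin 2 → Ω → ℂ) (σ p : ℝ) (i : Fin 2) (ω : Ω) :
    snr H σ p i ω = p / σ ^ 2 * gain H i i ω := by
  unfold snr; ring

theorem inr_eq {Ω : Type*} (H : Fin 2 → Fin 2 → Ω → ℂ) (σ p : ℝ) (i : Fin 2) (ω : Ω) :
    inr H σ p i ω = p / σ ^ 2 * gain H i (1 - i) ω := by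
  unfold inr; ring

section

variable {Ω : Type*} [MeasurableSpace Ω] {μ : Measure Ω} {H : Fin 2 → Fin 2 → Ω → ℂ}

theorem measurable_gain (hH : ∀ i q, Measurable (H i q)) (i q : Fin 2) :
    Measurable (gain H i q) := (hH i q).norm.pow_const 2

theorem measurable_snr (hH : ∀ i q, Measurable (H i q)) (σ p : ℝ) (i : Fin 2) :
    Measurable (snr H σ p i) := ((measurable_gain hH _ _).mul_const p).div_const _

theorem measurable_inr (hH : ∀ i q, Measurable (H i q)) (σ p : ℝ) (i : Fin 2) :
    Measurable (inr H σ p i) := ((measurable_gain hH _ _).mul_const p).div_const _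

/-- A gain with bounded density gives mass at most proportional to the length to an interval. -/
theorem RegularGains.exists_forall_measure_Icc_le (hreg : RegularGains μ H) (i q : Fin 2)
    (hH : ∀ i q, Measurable (H i q)) :
    ∃ M : ℝ, 0 < M ∧ ∀ u δ : ℝ, 0 ≤ δ →
      μ.map (gain H i q) (Set.Icc (u - δ) (u + δ)) ≤ ENNReal.ofReal (M * δ) := by
  obtain ⟨f, hf, hf0, hmap, M, hM⟩ := hreg.density i q
  refine ⟨2 * max M 1, by positivity, fun u δ hδ => ?_⟩
  -- The density is bounded only on the positive half-line; the rest carries no mass, as gains are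
  -- nonnegative and their law has no atom at 0.
  have hneg : μ.map (gain H i q) (Set.Iic 0) = 0 := by
    have h1 : μ.map (gain H i q) (Set.Iio 0) = 0 := by
      rw [Measure.map_apply (measurable_gain hH i q) measurableSet_Iio]
      have : gain H i q ⁻¹' Set.Iio 0 = ∅ := by
        ext ω
        simp only [Set.mem_preimage, Set.mem_Iio, Set.mem_empty_iff_false, iff_false, not_lt]
        exact sq_nonneg _
      rw [this, measure_empty]
    have h2 : μ.map (gain H i q) {0} = 0 := by
      rw [hmap]
      exact withDensity_absolutelyContinuous _ _ (measure_singleton 0)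
    rw [← Set.Iio_union_right]
    exact measure_union_null h1 h2
  have hsub : Set.Icc (u - δ) (u + δ) ⊆ Set.Iic 0 ∪ (Set.Icc (u - δ) (u + δ) ∩ Set.Ioi 0) := by
    intro x hx
    rcases le_or_gt x 0 with h | h
    · exact Or.inl h
    · exact Or.inr ⟨hx, h⟩
  refine (measure_mono hsub).trans ((measure_union_le _ _).trans ?_)
  have hm : MeasurableSet (Set.Icc (u - δ) (u + δ) ∩ Set.Ioi 0) :=
    measurableSet_Icc.inter measurableSet_Ioi
  rw [hneg, zero_add, hmap, withDensity_apply _ hm]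
  calc ∫⁻ h in Set.Icc (u - δ) (u + δ) ∩ Set.Ioi 0, ENNReal.ofReal (f h)
      ≤ ∫⁻ _ in Set.Icc (u - δ) (u + δ) ∩ Set.Ioi 0, ENNReal.ofReal (max M 1) :=
        setLIntegral_mono measurable_const fun h hh =>
          ENNReal.ofReal_le_ofReal ((hM h hh.2).trans (le_max_left _ _))
    _ = ENNReal.ofReal (max M 1) * volume (Set.Icc (u - δ) (u + δ) ∩ Set.Ioi 0) :=
        setLIntegral_const _ _
    _ ≤ ENNReal.ofReal (max M 1) * volume (Set.Icc (u - δ) (u + δ)) := by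
        gcongr
        exact Set.inter_subset_left
    _ = ENNReal.ofReal (2 * max M 1 * δ) := by
        rw [Real.volume_Icc, ← ENNReal.ofReal_mul (by positivity)]
        congr 1
        ring

variable [IsProbabilityMeasure μ]

/-- The opponent's type enters the utility only through his action, so the integral is an average
over two actions. -/
theorem payoff_bestResponse (hH : ∀ i q, Measurable (H i q)) (σ p a : ℝ) (i : Fin 2)
    (T : Strategy) (x y : ℝ) :
    payoff μ H σ p i T (bestResponse a) x y
      = mixedPayoff (T x y) (fdmProb μ H σ p (1 - i) a) x y := by
  have hT : Measurable (playerType H σ p (1 - i)) :=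
    (measurable_snr hH σ p _).prodMk (measurable_inr hH σ p _)
  have : IsProbabilityMeasure (μ.map (playerType H σ p (1 - i))) :=
    Measure.isProbabilityMeasure_map hT.aemeasurable
  set S := {t : ℝ × ℝ | bestResponse a t.1 t.2 = .FDM} with hSdef
  have hS : MeasurableSet S := measurableSet_bestResponse_eq_FDM a
  have e : ∀ t : ℝ × ℝ, utility (T x y) (bestResponse a t.1 t.2) x y
      = S.indicator (fun _ => utility (T x y) .FDM x y - utility (T x y) .FS x y) t
        + utility (T x y) .FS x y := by
    intro t
    by_cases h : t ∈ S
    · rw [Set.indicator_of_mem h, show bestResponse a t.1 t.2 = .FDM from h]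
      ring
    · rw [Set.indicator_of_notMem h]
      have : bestResponse a t.1 t.2 = .FS := by
        have h' : bestResponse a t.1 t.2 ≠ .FDM := h
        revert h'
        cases bestResponse a t.1 t.2 <;> simp
      rw [this, zero_add]
  have hp : (μ.map (playerType H σ p (1 - i))).real S = fdmProb μ H σ p (1 - i) a := by
    rw [map_measureReal_apply hT hS]
    rfl
  unfold payoff
  simp_rw [e]
  rw [integral_add ((integrable_const _).indicator hS) (integrable_const _),
    integral_indicator_const _ hS, hp, integral_const]
  simp only [mixedPayoff, smul_eq_mul, probReal_univ]
  ring

/-! ### From solutions of the system to near equilibria -/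

/-- The threshold rule and the best response differ with probability at most the concentration
of the direct gain at scale `4 σ ^ 2 / p`. -/
theorem abs_one_sub_distFun_sub_fdmProb_le (hH : ∀ i q, Measurable (H i q))
    (hind : iIndepFun (fun k : Fin 2 × Fin 2 => gain H k.1 k.2) μ)
    (hcont : ∀ i q, ∀ h : ℝ, μ {ω | gain H i q ω = h} = 0) {σ p η : ℝ} (hσ : 0 < σ) (hp : 0 < p)
    (hη : 0 ≤ η) (j : Fin 2)
    (hconc : ∀ u, μ.map (gain H j j)
      (Set.Icc (u - 4 * (σ ^ 2 / p)) (u + 4 * (σ ^ 2 / p))) ≤ ENNReal.ofReal η)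
    {a : ℝ} (h0 : 0 ≤ a) (h1 : a ≤ 1) :
    |1 - distFun μ (isr H σ p j) (threshold a) - fdmProb μ H σ p j a| ≤ η := by
  have hs : 0 < p / σ ^ 2 := by positivity
  have hnn : ∀ i q ω, 0 ≤ gain H i q ω := fun i q ω => sq_nonneg _
  have hisr : Measurable (isr H σ p j) := (measurable_inr hH σ p j).div (measurable_snr hH σ p j)
  rcases h0.eq_or_lt with rfl | h0
  · have e1 : distFun μ (isr H σ p j) (threshold 0) = 1 := by
      simp [distFun, threshold_zero]
    have e2 : fdmProb μ H σ p j 0 = 0 := by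
      have : {ω | bestResponse 0 (snr H σ p j ω) (inr H σ p j ω) = .FDM} = ∅ := by
        ext ω
        have h : advantage (snr H σ p j ω) (inr H σ p j ω) 0 ≤ 0 := by
          rw [snr_eq, inr_eq]
          exact advantage_zero_nonpos (mul_nonneg hs.le (hnn _ _ _)) (mul_nonneg hs.le (hnn _ _ _))
        simp [bestResponse, h.not_gt]
      rw [fdmProb, this, measureReal_empty]
    rw [e1, e2]
    simpa using hη
  · obtain ⟨q, ⟨hq, hr⟩, -⟩ := existsUnique_rFun_eq_zero h0 h1
    rw [threshold_eq h0 h1 hq hr]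
    have e1 : 1 - distFun μ (isr H σ p j) (q : EReal) = μ.real {ω | q < isr H σ p j ω} := by
      have hm : MeasurableSet {ω | isr H σ p j ω ≤ q} := measurableSet_le hisr measurable_const
      have e : {ω | q < isr H σ p j ω} = {ω | isr H σ p j ω ≤ q}ᶜ := by
        ext ω; simp
      rw [e, probReal_compl_eq_one_sub hm]
      simp [distFun]
    rw [e1, fdmProb]
    have hI : IndepFun (gain H j j) (gain H j (1 - j)) μ :=
      hind.indepFun (i := (j, j)) (j := (j, 1 - j)) (by fin_cases j <;> simp)
    set B := {ω | |gain H j j ω - q⁻¹ * gain H j (1 - j) ω| ≤ 4 * (σ ^ 2 / p)} with hB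
    have hBη : μ B ≤ ENNReal.ofReal η :=
      measure_abs_sub_le_of_indepFun (measurable_gain hH _ _) (measurable_gain hH _ _) hI hconc q⁻¹
    -- Off this null set both SNR and INR are positive, as the threshold comparison requires.
    set N := {ω | gain H j j ω = 0} ∪ {ω | gain H j (1 - j) ω = 0} with hN
    have hN0 : μ N = 0 := measure_union_null (hcont _ _ _) (hcont _ _ _)
    have hBN : μ.real (B ∪ N) ≤ η := by
      rw [measureReal_def]
      refine ENNReal.toReal_le_of_le_ofReal hη ?_
      refine (measure_union_le _ _).trans ?_
      rw [hN0, add_zero]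
      exact hBη
    have hagree : ∀ ω, ω ∉ B ∪ N →
        (bestResponse a (snr H σ p j ω) (inr H σ p j ω) = .FDM ↔ q < isr H σ p j ω) := by
      intro ω hω
      simp only [hB, hN, Set.mem_union, Set.mem_ofPred_eq, not_or, not_le] at hω
      obtain ⟨hω1, hω2, hω3⟩ := hω
      have hx : 0 < snr H σ p j ω := by
        rw [snr_eq]; exact mul_pos hs (lt_of_le_of_ne (hnn _ _ _) (Ne.symm hω2))
      have hy : 0 < inr H σ p j ω := by
        rw [inr_eq]; exact mul_pos hs (lt_of_le_of_ne (hnn _ _ _) (Ne.symm hω3))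
      refine bestResponse_eq_FDM_iff h0 h1 hq hr hx hy ?_
      have e : snr H σ p j ω - q⁻¹ * inr H σ p j ω
          = p / σ ^ 2 * (gain H j j ω - q⁻¹ * gain H j (1 - j) ω) := by
        rw [snr_eq, inr_eq]; ring
      rw [e, abs_mul, abs_of_pos hs]
      calc (4 : ℝ) = p / σ ^ 2 * (4 * (σ ^ 2 / p)) := by field_simp
        _ < _ := mul_lt_mul_of_pos_left hω1 hs
    have hcomp : ∀ A C : Set Ω, (∀ ω, ω ∉ B ∪ N → ω ∈ A → ω ∈ C) → μ.real A ≤ μ.real C + η := by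
      intro A C h
      have hsub : A ⊆ C ∪ (B ∪ N) := by
        intro ω hω
        by_cases hb : ω ∈ B ∪ N
        · exact Or.inr hb
        · exact Or.inl (h ω hb hω)
      have := (measureReal_mono (μ := μ) hsub).trans (measureReal_union_le _ _)
      linarith
    have i1 := hcomp {ω | q < isr H σ p j ω}
      {ω | bestResponse a (snr H σ p j ω) (inr H σ p j ω) = .FDM}
      (fun ω hω h => (hagree ω hω).2 h)
    have i2 := hcomp {ω | bestResponse a (snr H σ p j ω) (inr H σ p j ω) = .FDM}
      {ω | q < isr H σ p j ω} (fun ω hω h => (hagree ω hω).1 h)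
    rw [abs_le]
    constructor <;> linarith

/-- The profile of a solution is a near equilibrium as soon as the direct gains concentrate
little mass at scale `4 σ ^ 2 / p`. -/
theorem isNearNash_profile (hH : ∀ i q, Measurable (H i q))
    (hind : iIndepFun (fun k : Fin 2 × Fin 2 => gain H k.1 k.2) μ)
    (hcont : ∀ i q, ∀ h : ℝ, μ {ω | gain H i q ω = h} = 0) {σ p η : ℝ} (hσ : 0 < σ) (hp : 0 < p)
    (hη : 0 ≤ η)
    (hconc : ∀ j u, μ.map (gain H j j)
      (Set.Icc (u - 4 * (σ ^ 2 / p)) (u + 4 * (σ ^ 2 / p))) ≤ ENNReal.ofReal η)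
    {a : Fin 2 → ℝ} (ha : IsSolution μ H σ p a) : IsNearNash μ H σ p η (profile a) := by
  have ha01 : ∀ i, 0 ≤ a i ∧ a i ≤ 1 := by
    intro i
    rw [ha i]
    exact ⟨sub_nonneg.2 (measureReal_le_one), sub_le_self _ (measureReal_nonneg)⟩
  intro i T x y hx hy
  have e : profile a (1 - i) = bestResponse (a i) := by
    rw [profile, sub_sub_cancel]
  rw [e, payoff_bestResponse hH, payoff_bestResponse hH]
  have key := abs_one_sub_distFun_sub_fdmProb_le hH hind hcont hσ hp hη (1 - i) (hconc (1 - i))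
    (ha01 i).1 (ha01 i).2
  have hsol := ha (1 - i)
  rw [sub_sub_cancel] at hsol
  rw [← hsol] at key
  have hloss := mixedPayoff_sub_le (a := a (1 - i)) (b := fdmProb μ H σ p (1 - i) (a i))
    measureReal_nonneg measureReal_le_one hx hy (T x y)
  change _ ≤ mixedPayoff (bestResponse (a (1 - i)) x y) _ x y
  linarith

/-- The direct gains have uniformly small mass on intervals of length of order `σ ^ 2 / p` once
`p / σ ^ 2` is large. -/
theorem exists_forall_isNearNash_profile (hH : ∀ i q, Measurable (H i q))
    (hind : iIndepFun (fun k : Fin 2 × Fin 2 => gain H k.1 k.2) μ)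
    (hcont : ∀ i q, ∀ h : ℝ, μ {ω | gain H i q ω = h} = 0) {ε : ℝ} (hε : 0 < ε) :
    ∃ s₀ : ℝ, 0 < s₀ ∧ ∀ σ p : ℝ, 0 < σ → 0 < p → s₀ * σ ^ 2 < p → ∀ a : Fin 2 → ℝ,
      IsSolution μ H σ p a → IsNearNash μ H σ p ε (profile a) := by
  have hδ : ∀ j, ∃ δ : ℝ, 0 < δ ∧
      ∀ u, μ.map (gain H j j) (Set.Icc (u - δ) (u + δ)) ≤ ENNReal.ofReal ε := by
    intro j
    have : IsProbabilityMeasure (μ.map (gain H j j)) :=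
      Measure.isProbabilityMeasure_map (measurable_gain hH j j).aemeasurable
    have : NullSingletonClass (μ.map (gain H j j)) := ⟨fun h => by
      rw [Measure.map_apply (measurable_gain hH j j) (measurableSet_singleton h)]
      exact hcont j j h⟩
    exact exists_forall_measure_Icc_le _ hε
  choose δ hδ0 hδ using hδ
  set d := min (δ 0) (δ 1) with hd
  have hd0 : 0 < d := lt_min (hδ0 0) (hδ0 1)
  have hdj : ∀ j, d ≤ δ j := by
    intro j
    fin_cases j
    · exact min_le_left _ _
    · exact min_le_right _ _
  -- This choice makes the half-width `4σ²/p` smaller than `d`.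
  refine ⟨4 / d, by positivity, fun σ p hσ hp hs a ha => ?_⟩
  refine isNearNash_profile hH hind hcont hσ hp hε.le (fun j u => ?_) ha
  have hle : 4 * (σ ^ 2 / p) ≤ δ j := by
    refine le_trans ?_ (hdj j)
    rw [← mul_div_assoc, div_le_iff₀ hp]
    rw [div_mul_eq_mul_div, div_lt_iff₀ hd0] at hs
    linarith
  refine (measure_mono ?_).trans (hδ j u)
  exact Set.Icc_subset_Icc (by linarith) (by linarith)

theorem integral_gain_pos
    (hcont : ∀ i q, ∀ h : ℝ, μ {ω | gain H i q ω = h} = 0) {i q : Fin 2}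
    (hint : Integrable (gain H i q) μ) : 0 < ∫ ω, gain H i q ω ∂μ := by
  rw [integral_pos_iff_support_of_nonneg (f := gain H i q) (fun ω => sq_nonneg _) hint]
  have e : Function.support (gain H i q) = {ω | gain H i q ω = 0}ᶜ := rfl
  rw [e, pos_iff_ne_zero]
  intro h
  have := measure_univ_le_add_compl (μ := μ) {ω | gain H i q ω = 0}
  rw [h, hcont] at this
  simp at this

end

end BIG

theorem mainTheorem1 {Ω : Type*} [MeasurableSpace Ω] (μ : Measure Ω) [IsProbabilityMeasure μ]
    (H : Fin 2 → Fin 2 → Ω → ℂ) (hH : ∀ i q, Measurable (H i q))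
    (hind : iIndepFun (fun k : Fin 2 × Fin 2 => BIG.gain H k.1 k.2) μ)
    (hcont : ∀ i q, ∀ h : ℝ, μ {ω | BIG.gain H i q ω = h} = 0) :
    (∀ σ : ℝ, 0 < σ → ∀ ε : ℝ, 0 < ε → ∃ p₀ : ℝ, 0 < p₀ ∧ ∀ p : ℝ, p₀ < p →
      ∀ a : Fin 2 → ℝ, BIG.IsSolution μ H σ p a →
        BIG.IsNearNash μ H σ p ε (BIG.profile a)) ∧
    ((∀ i, Integrable (BIG.gain H i i) μ) →
      ∀ ε : ℝ, 0 < ε → ∃ SNR₀ : ℝ, ∀ σ p : ℝ, 0 < σ → 0 < p →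
        (∀ i, SNR₀ < ∫ ω, BIG.snr H σ p i ω ∂μ) →
        ∀ a : Fin 2 → ℝ, BIG.IsSolution μ H σ p a →
          BIG.IsNearNash μ H σ p ε (BIG.profile a)) ∧
    (BIG.RegularGains μ H →
      ∀ ν : ℝ, 0 < ν → ν < 1 → ∃ K : ℝ, 0 < K ∧ ∀ σ : ℝ, 0 < σ → ∃ p₀ : ℝ, 0 < p₀ ∧
        ∀ p : ℝ, p₀ < p → ∀ a : Fin 2 → ℝ, BIG.IsSolution μ H σ p a →
          ∀ i, BIG.IsNearNash μ H σ p (K * BIG.rate μ H σ p ν i) (BIG.profile a)) := by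
  refine ⟨fun σ hσ ε hε => ?_, fun hint ε hε => ?_, fun hreg ν _ _ => ?_⟩
  · obtain ⟨s₀, hs₀, h⟩ := BIG.exists_forall_isNearNash_profile hH hind hcont hε
    refine ⟨s₀ * σ ^ 2, by positivity, fun p hp a ha => h σ p hσ ?_ hp a ha⟩
    exact lt_trans (by positivity) hp
  · obtain ⟨s₀, hs₀, h⟩ := BIG.exists_forall_isNearNash_profile hH hind hcont hε
    -- The mean SNR is `p / σ²` times the positive mean gain, so a bound on it forces `s₀ < p / σ²`.
    refine ⟨s₀ * ∫ ω, BIG.gain H 0 0 ω ∂μ, fun σ p hσ hp hsnr a ha => h σ p hσ hp ?_ a ha⟩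
    have hg := BIG.integral_gain_pos hcont (hint 0)
    have h0 := hsnr 0
    simp_rw [BIG.snr_eq] at h0
    rw [integral_const_mul] at h0
    exact (lt_div_iff₀ (by positivity)).1 (lt_of_mul_lt_mul_right h0 hg.le)
  · choose M hM0 hM using fun j => hreg.exists_forall_measure_Icc_le j j hH
    -- The 4 comes from the half-width `4σ²/p`, and the sum dominates both density constants. The
    -- value 1 serves only to make `p` positive.
    refine ⟨4 * (M 0 + M 1), by linarith [hM0 0, hM0 1], fun σ hσ => ⟨1, one_pos, ?_⟩⟩
    intro p hp a ha i
    have hp0 : 0 < p := one_pos.trans hp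
    have hM01 : 0 < M 0 + M 1 := add_pos (hM0 0) (hM0 1)
    have hd : 0 < σ ^ 2 / p := by positivity
    -- The sum of products of distribution functions is nonnegative and can be dropped.
    have hrate : σ ^ 2 / p ≤ BIG.rate μ H σ p ν i :=
      le_add_of_nonneg_right (Finset.sum_nonneg fun q _ =>
        mul_nonneg (cdf_nonneg _ _) (cdf_nonneg _ _))
    refine BIG.isNearNash_profile hH hind hcont hσ hp0
      (mul_nonneg (by linarith) (hd.le.trans hrate)) (fun j u => ?_) ha
    refine (hM j u _ (by positivity)).trans (ENNReal.ofReal_le_ofReal ?_)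
    have hMj : M j ≤ M 0 + M 1 := by
      fin_cases j
      · exact le_add_of_nonneg_right (hM0 1).le
      · exact le_add_of_nonneg_left (hM0 0).le
    have := mul_le_mul hMj hrate hd.le hM01.le
    linarith
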